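/- For a prime $p$ and an integer $k\ge 0$ put $\psi(p^k)=(p^k-1)(p^{k-1}-1)\cdots(p-1)$ (so $\psi(1)=1$). For a finite group $G$, let $D$ be the intersection of all normal subgroups of $G$ whose index in $G$ is a power of $p$ (including $p^0=1$); the quotient $G/D$ is called the maximal $p$-factor group of $G$. Theorem. Let $G$ be a finite group of order $n$, let $p$ be a prime, and let $p^a$ ($a\ge 0$) be the largest power of $p$ dividing $n$. Suppose that $\gcd(n,\psi(p^a))=1$. Then the maximal $p$-factor group of $G$ is isomorphic to every Sylow $p$-subgroup of $G$. Moreover, $G$ has a normal $p$-complement, that is, a normal subgroup $N$ such that $N\cap P=1$ and $NP=G$ for every Sylow $p$-subgroup $P$ of $G$. -/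

import Mathlib

/-- The multiplicative function `ψ` with
`ψ (p ^ k) = (p ^ k - 1) * (p ^ (k - 1) - 1) * ⋯ * (p - 1)` on prime powers. -/
def psi (n : ℕ) : ℕ :=
  ∏ p ∈ n.primeFactors, ∏ i ∈ Finset.Icc 1 (n.factorization p), (p ^ i - 1)

theorem psi_prime_pow {p : ℕ} (hp : p.Prime) (k : ℕ) :
    psi (p ^ k) = ∏ i ∈ Finset.Icc 1 k, (p ^ i - 1) := by
  rcases Nat.eq_zero_or_pos k with rfl | hk
  · simp [psi]
  · simp [psi, Nat.primeFactors_prime_pow hk.ne' hp, hp.factorization_self]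

theorem psi_mul {m n : ℕ} (h : m.Coprime n) : psi (m * n) = psi m * psi n := by
  unfold psi
  rw [h.primeFactors_mul, Finset.prod_union h.disjoint_primeFactors]
  congr 1
  · refine Finset.prod_congr rfl fun p hp => ?_
    rw [Nat.factorization_eq_of_coprime_left h (by simpa using hp)]
  · refine Finset.prod_congr rfl fun p hp => ?_
    rw [Nat.factorization_eq_of_coprime_right h (by simpa using hp)]

/-- The intersection of all normal subgroups of `G` whose index is a power of `p`. -/
def pResidual (p : ℕ) (G : Type*) [Group G] : Subgroup G :=
  sInf {N : Subgroup G | N.Normal ∧ ∃ k : ℕ, N.index = p ^ k}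

instance pResidual_normal (p : ℕ) (G : Type*) [Group G] : (pResidual p G).Normal :=
  ⟨fun x hx g => Subgroup.mem_sInf.2 fun N hN =>
    hN.1.conj_mem x (Subgroup.mem_sInf.1 hx N hN) g⟩

/-- The maximal `p`-factor group of `G`. -/
abbrev MaximalPFactorGroup (p : ℕ) (G : Type*) [Group G] : Type _ :=
  G ⧸ pResidual p G

/-! An automorphism of prime order `q ≠ p` of a `p`-group of order `p ^ k` fixing just `p ^ j`
points, `j < k`, forces `q ∣ p ^ (k - j) - 1`. Hence `N(D)/C(D)` is a `p`-group for every
`p`-subgroup `D`. An Alperin-style induction on Sylow intersections then shows that a Sylow subgroup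
`P` controls its own fusion, so its focal subgroup lies in `P'`, which is proper if `P ≠ 1`.
Transfer gives a proper normal subgroup of `p`-power index, and induction on the order gives a
normal `p`-complement, which is the `p`-residual. -/

/-- No prime divisor of the order of `G` divides `p ^ i - 1` for a nontrivial power `p ^ i`
dividing the order of `G`. -/
def CoprimePsi (p : ℕ) (G : Type*) [Group G] : Prop :=
  ∀ q : ℕ, q.Prime → q ∣ Nat.card G → ∀ i : ℕ, 1 ≤ i → p ^ i ∣ Nat.card G → ¬ q ∣ p ^ i - 1

theorem CoprimePsi.subgroup {p : ℕ} {G : Type*} [Group G] (h : CoprimePsi p G) (H : Subgroup G) :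
    CoprimePsi p H := fun q hq hqH i hi hpi =>
  h q hq (hqH.trans H.card_subgroup_dvd_card) i hi (hpi.trans H.card_subgroup_dvd_card)

/-- An automorphism of prime order `q ≠ p` of a finite `p`-group `D` is trivial if `q` divides no
`p ^ i - 1` with `1 ≤ i` and `p ^ i ∣ |D|`. -/
theorem IsPGroup.mulAut_eq_one_of_pow_eq_one {p q : ℕ} (hp : p.Prime) (hq : q.Prime) (hqp : q ≠ p)
    {D : Type*} [Group D] [Finite D] (hD : IsPGroup p D)
    (h : ∀ i : ℕ, 1 ≤ i → p ^ i ∣ Nat.card D → ¬ q ∣ p ^ i - 1)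
    (f : MulAut D) (hf : f ^ q = 1) : f = 1 := by
  have := Fact.mk hp
  have := Fact.mk hq
  have hz : IsPGroup q (Subgroup.zpowers f) := by
    refine IsPGroup.of_card_dvd_pow (n := 1) ?_
    rw [Nat.card_zpowers, pow_one]
    exact orderOf_dvd_of_pow_eq_one hf
  let F : Subgroup D := FixedPoints.subgroup (Subgroup.zpowers f) D
  have hmod : Nat.card D ≡ Nat.card F [MOD q] := hz.card_modEq_card_fixedPoints D
  obtain ⟨k, hk⟩ := hD.exists_card_eq
  obtain ⟨j, hj⟩ := (hD.to_subgroup F).exists_card_eq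
  have hdvd : p ^ j ∣ p ^ k := by rw [← hk, ← hj]; exact F.card_subgroup_dvd_card
  have hjk : j ≤ k := (Nat.pow_dvd_pow_iff_le_right hp.one_lt).1 hdvd
  have hF : F = ⊤ := by
    rcases hjk.eq_or_lt with rfl | hlt
    · exact Subgroup.eq_top_of_card_eq F (hj.trans hk.symm)
    · exfalso
      rw [hk, hj] at hmod
      have h1 : q ∣ p ^ k - p ^ j := (Nat.modEq_iff_dvd' (Nat.le_of_dvd (pow_pos hp.pos k) hdvd)).1
        hmod.symm
      have h2 : p ^ k - p ^ j = p ^ j * (p ^ (k - j) - 1) := by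
        rw [Nat.mul_sub, ← pow_add, Nat.add_sub_cancel' hjk, mul_one]
      rw [h2] at h1
      refine h (k - j) (by omega) ?_ ((hq.dvd_mul.1 h1).resolve_left fun h3 => hqp ?_)
      · rw [hk]; exact pow_dvd_pow p (Nat.sub_le k j)
      · exact (Nat.prime_dvd_prime_iff_eq hq hp).1 (hq.dvd_of_dvd_pow h3)
  ext x
  have hx : x ∈ F := hF ▸ Subgroup.mem_top x
  exact hx ⟨f, Subgroup.mem_zpowers f⟩

/-- The automizer of a `p`-subgroup is a `p`-group. -/
theorem CoprimePsi.isPGroup_range_normalizerMonoidHom {p : ℕ} (hp : p.Prime) {G : Type*} [Group G]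
    [Finite G] (h : CoprimePsi p G) (D : Subgroup G) (hD : IsPGroup p D) :
    IsPGroup p D.normalizerMonoidHom.range := by
  refine IsPGroup.of_card (Nat.eq_prime_pow_of_unique_prime_dvd Nat.card_pos.ne' ?_)
  intro q hq hqd
  by_contra hqp
  have := Fact.mk hq
  obtain ⟨x, hx⟩ := exists_prime_orderOf_dvd_card' q hqd
  have hqG : q ∣ Nat.card G :=
    (hqd.trans (Subgroup.card_range_dvd _)).trans (Subgroup.card_subgroup_dvd_card _)
  have hx1 : (x : MulAut D) = 1 := by
    refine hD.mulAut_eq_one_of_pow_eq_one hp hq hqp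
      (fun i hi hpi => h q hq hqG i hi (hpi.trans D.card_subgroup_dvd_card)) x ?_
    rw [← Subgroup.coe_pow, ← hx, pow_orderOf_eq_one, Subgroup.coe_one]
  have : x = 1 := Subtype.ext hx1
  rw [this, orderOf_one] at hx
  exact hq.one_lt.ne hx

/-- The index of the join divides both a power of `p` (the automizer's order) and a number prime to
`p`. -/
theorem CoprimePsi.centralizer_sup_sylow_eq_top {p : ℕ} (hp : p.Prime) {G : Type*} [Group G]
    [Finite G] (h : CoprimePsi p G) (D : Subgroup G) (hD : IsPGroup p D)
    (U : Sylow p (Subgroup.normalizer (D : Set G))) :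
    D.normalizerMonoidHom.ker ⊔ (U : Subgroup (Subgroup.normalizer (D : Set G))) = ⊤ := by
  have := Fact.mk hp
  obtain ⟨k, hk⟩ := (h.isPGroup_range_normalizerMonoidHom hp D hD).exists_card_eq
  rw [← Subgroup.index_ker] at hk
  rw [← Subgroup.index_eq_one]
  refine Nat.eq_one_of_dvd_coprimes ?_ (Subgroup.index_dvd_of_le le_sup_left)
    (Subgroup.index_dvd_of_le le_sup_right)
  rw [hk]
  exact Nat.Coprime.pow_left k ((Nat.Prime.coprime_iff_not_dvd hp).2 U.not_dvd_index)

/-- Normalizers grow in `p`-groups. -/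
theorem IsPGroup.lt_normalizer_inf {p : ℕ} (hp : p.Prime) {G : Type*} [Group G] [Finite G]
    {D S : Subgroup G} (hS : IsPGroup p S) (hDS : D < S) :
    D < Subgroup.normalizer (D : Set G) ⊓ S := by
  have := Fact.mk hp
  have : Group.IsNilpotent S := hS.isNilpotent
  refine lt_of_le_of_ne (le_inf D.le_normalizer hDS.le) fun heq => ?_
  have hc := Group.normalizerCondition_of_isNilpotent (G := S) (D.subgroupOf S)
    (lt_top_iff_ne_top.2 fun ht => hDS.not_ge (Subgroup.subgroupOf_eq_top.1 ht))
  refine hc.not_ge fun x hx => ?_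
  have hxN : (x : G) ∈ Subgroup.normalizer (D : Set G) := by
    rw [Subgroup.mem_normalizer_iff'] at hx ⊢
    intro y
    constructor
    · intro hy
      have hyS : y ∈ S := by
        have := S.mul_mem (hDS.le hy) (S.inv_mem x.2)
        simpa using this
      exact (hx ⟨y, hyS⟩).1 hy
    · intro hy
      have hyS : y ∈ S := by
        have := S.mul_mem (S.inv_mem x.2) (hDS.le hy)
        simpa using this
      exact (hx ⟨y, hyS⟩).2 hy
  have : (x : G) ∈ D := heq ▸ ⟨hxN, x.2⟩
  exact this

/-- Two Sylow subgroups are conjugate by an element centralizing their intersection. -/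
theorem CoprimePsi.exists_mem_centralizer_smul_eq {p : ℕ} (hp : p.Prime) {G : Type*} [Group G]
    [Finite G] (h : CoprimePsi p G) (S T : Sylow p G) :
    ∃ c ∈ Subgroup.centralizer (((S : Subgroup G) ⊓ T : Subgroup G) : Set G), c • S = T := by
  have := Fact.mk hp
  -- Larger intersections are treated first.
  induction hn : Nat.card G - Nat.card ((S : Subgroup G) ⊓ T : Subgroup G)
    using Nat.strong_induction_on generalizing S T with
  | _ n ih =>
  subst hn
  by_cases hST : S = T
  · exact ⟨1, Subgroup.one_mem _, by rw [one_smul, hST]⟩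
  set D : Subgroup G := (S : Subgroup G) ⊓ T with hDdef
  have hD : IsPGroup p D := S.2.to_le inf_le_left
  have hDS : D < S := by
    refine lt_of_le_of_ne inf_le_left fun he => hST ?_
    exact Sylow.ext (S.3 T.2 (inf_eq_left.1 he)).symm
  have hDT : D < T := by
    refine lt_of_le_of_ne inf_le_right fun he => hST ?_
    exact Sylow.ext (T.3 S.2 (inf_eq_right.1 he))
  have hlt : ∀ {E : Subgroup G}, D < E → Nat.card G - Nat.card E < Nat.card G - Nat.card D := by
    intro E hE
    have h1 : Nat.card D < Nat.card E := Set.Finite.card_lt_card (Set.toFinite _) hE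
    have h2 : Nat.card E ≤ Nat.card G := E.card_le_card_group
    omega
  have hNS := S.2.lt_normalizer_inf hp hDS
  have hNT := T.2.lt_normalizer_inf hp hDT
  set N := Subgroup.normalizer (D : Set G)
  obtain ⟨U, hU⟩ := IsPGroup.exists_le_sylow (G := N) (P := (S : Subgroup G).subgroupOf N)
    (S.2.comap_of_injective N.subtype N.subtype_injective)
  obtain ⟨V, hV⟩ := IsPGroup.exists_le_sylow (G := N) (P := (T : Subgroup G).subgroupOf N)
    (T.2.comap_of_injective N.subtype N.subtype_injective)
  obtain ⟨c, hc⟩ := MulAction.exists_smul_eq N U V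
  have hcm : c ∈ D.normalizerMonoidHom.ker ⊔ (U : Subgroup N) := by
    rw [h.centralizer_sup_sylow_eq_top hp D hD U]; exact Subgroup.mem_top c
  obtain ⟨c₀, hc₀, u, hu, rfl⟩ := Subgroup.mem_sup_of_normal_left.1 hcm
  -- Since `u` fixes `U`, the centralizing factor `c₀` alone carries `U` to `V`.
  rw [mul_smul, Sylow.smul_eq_iff_mem_normalizer.2 (Subgroup.le_normalizer hu)] at hc
  have hc₀C : (c₀ : G) ∈ Subgroup.centralizer (D : Set G) := by
    rw [Subgroup.normalizerMonoidHom_ker] at hc₀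
    exact hc₀
  -- `S'` contains `N_S(D)` and `c₀ • S'` contains `N_T(D)`, so `S ⊓ S'` and `(c₀ • S') ⊓ T` both
  -- exceed `D`.
  obtain ⟨S', hS'⟩ := IsPGroup.exists_le_sylow (G := G) (U.2.map N.subtype)
  have hSS' : D < (S : Subgroup G) ⊓ S' := hNS.trans_le
    (le_inf inf_le_right fun x hx => hS' ⟨⟨x, hx.1⟩, hU hx.2, rfl⟩)
  have hS'T : D < (((c₀ : G) • S' : Sylow p G) : Subgroup G) ⊓ T := by
    refine hNT.trans_le (le_inf (fun x hx => ?_) inf_le_right)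
    have hxV : (⟨x, hx.1⟩ : N) ∈ (c₀ • U : Sylow p N) := hc ▸ hV hx.2
    obtain ⟨y, hy, hyx⟩ := hxV
    refine ⟨y, hS' ⟨y, hy, rfl⟩, ?_⟩
    exact congrArg Subtype.val hyx
  obtain ⟨c₁, hc₁, hc₁S⟩ := ih _ (hlt hSS') S S' rfl
  obtain ⟨c₂, hc₂, hc₂S⟩ := ih _ (hlt hS'T) ((c₀ : G) • S') T rfl
  refine ⟨c₂ * (c₀ * c₁), Subgroup.mul_mem _ (Subgroup.centralizer_le hS'T.le hc₂)
    (Subgroup.mul_mem _ hc₀C (Subgroup.centralizer_le hSS'.le hc₁)), ?_⟩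
  rw [mul_smul, mul_smul, hc₁S, hc₂S]

theorem IsPGroup.commutator_lt {p : ℕ} (hp : p.Prime) {G : Type*} [Group G] [Finite G]
    {H : Subgroup G} (hH : IsPGroup p H) (hne : H ≠ ⊥) : ⁅H, H⁆ < H := by
  have := Fact.mk hp
  have : Group.IsNilpotent H := hH.isNilpotent
  have : Nontrivial H := (Subgroup.nontrivial_iff_ne_bot H).2 hne
  have h := Group.IsSolvable.commutator_lt_top_of_nontrivial H
  rwa [← Subgroup.map_subtype_lt_map_subtype, Subgroup.map_subtype_commutator,
    ← MonoidHom.range_eq_map, H.range_subtype] at h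

/-- A Sylow subgroup controls its own fusion. -/
theorem CoprimePsi.exists_conj_eq {p : ℕ} (hp : p.Prime) {G : Type*} [Group G] [Finite G]
    (h : CoprimePsi p G) (P : Sylow p G) {x g : G} (hx : x ∈ P) (hgx : g * x * g⁻¹ ∈ P) :
    ∃ y ∈ P, y * x * y⁻¹ = g * x * g⁻¹ := by
  have := Fact.mk hp
  have hx' : x ∈ (g⁻¹ • P : Sylow p G) := by
    refine ⟨g * x * g⁻¹, hgx, ?_⟩
    simp [mul_assoc]
  obtain ⟨c, hc, hcP⟩ := h.exists_mem_centralizer_smul_eq hp P (g⁻¹ • P)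
  have hcx : x * c = c * x := hc x ⟨hx, hx'⟩
  have hgc : (g * c) ∈ Subgroup.normalizer ((P : Subgroup G) : Set G) := by
    exact Sylow.smul_eq_iff_mem_normalizer.1 (by rw [mul_smul, hcP, smul_inv_smul])
  have hm : (⟨g * c, hgc⟩ : Subgroup.normalizer ((P : Subgroup G) : Set G)) ∈
      ((P.subtype Subgroup.le_normalizer : Sylow p _) : Subgroup _) ⊔
        (P : Subgroup G).normalizerMonoidHom.ker := by
    rw [sup_comm, h.centralizer_sup_sylow_eq_top hp P P.2]; exact Subgroup.mem_top _
  obtain ⟨u, hu, z, hz, huz⟩ := Subgroup.mem_sup_of_normal_right.1 hm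
  rw [Subgroup.normalizerMonoidHom_ker] at hz
  have hzx : x * z = z * x := hz x hx
  have he : (u : G) * z = g * c := congrArg Subtype.val huz
  refine ⟨u, hu, ?_⟩
  have h1 : (u : G) * x * (u : G)⁻¹ = (u * z : G) * x * (u * z : G)⁻¹ := by
    rw [mul_inv_rev, mul_assoc (u : G) z x, ← hzx]; group
  have h2 : g * x * g⁻¹ = (g * c) * x * (g * c)⁻¹ := by
    rw [mul_inv_rev, mul_assoc g c x, ← hcx]; group
  rw [h1, h2, he]

open scoped commutatorElement in
theorem CoprimePsi.focalSubgroup_le_commutator {p : ℕ} (hp : p.Prime) {G : Type*} [Group G]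
    [Finite G] (h : CoprimePsi p G) (P : Sylow p G) :
    (P : Subgroup G).focalSubgroup ≤ ⁅(P : Subgroup G), (P : Subgroup G)⁆ := by
  rw [Subgroup.focalSubgroup_def, Subgroup.closure_le]
  rintro _ ⟨hg, x, hx, u, rfl⟩
  have hm : u * x⁻¹ * u⁻¹ ∈ P := by
    have : _ ∈ (P : Subgroup G) := P.mul_mem (P.inv_mem hx) hg
    rw [commutatorElement_def] at this
    change _ ∈ (P : Subgroup G)
    simpa [mul_assoc] using this
  obtain ⟨y, hy, hyx⟩ := h.exists_conj_eq hp P (P.inv_mem hx) hm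
  -- `⁅x, u⁆` depends on `u` only through the conjugate of `x⁻¹`.
  have he : ⁅x, u⁆ = ⁅x, y⁆ := by
    simp only [commutatorElement_def, mul_assoc] at hyx ⊢
    rw [hyx]
  rw [he]
  exact Subgroup.commutator_mem_commutator hx hy

/-- A normal subgroup of order prime to `p` and of `p`-power index consists of the elements of
order prime to `p`. -/
theorem Subgroup.mem_iff_not_dvd_orderOf {p : ℕ} (hp : p.Prime) {G : Type*} [Group G] [Finite G]
    (N : Subgroup G) [N.Normal] (hN : ¬ p ∣ Nat.card N) {k : ℕ} (hk : N.index = p ^ k) (x : G) :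
    x ∈ N ↔ ¬ p ∣ orderOf x := by
  refine ⟨fun hx hd => hN (hd.trans (N.orderOf_dvd_natCard hx)), fun hx => ?_⟩
  rw [← QuotientGroup.eq_one_iff, ← orderOf_eq_one_iff]
  refine Nat.eq_one_of_dvd_coprimes (((Nat.Prime.coprime_iff_not_dvd hp).2 hx).pow_left k) ?_
    (orderOf_map_dvd (QuotientGroup.mk' N) x)
  rw [← hk]
  exact _root_.orderOf_dvd_natCard (x : G ⧸ N)

/-- A finite group satisfying `CoprimePsi p` is `p`-nilpotent. -/
theorem CoprimePsi.exists_normal_not_dvd_card {p : ℕ} (hp : p.Prime) {G : Type*} [Group G]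
    [Finite G] (h : CoprimePsi p G) :
    ∃ N : Subgroup G, N.Normal ∧ ¬ p ∣ Nat.card N ∧ ∃ k : ℕ, N.index = p ^ k := by
  have := Fact.mk hp
  induction hn : Nat.card G using Nat.strong_induction_on generalizing G with
  | _ n ih =>
  subst hn
  by_cases hpG : p ∣ Nat.card G
  swap
  · exact ⟨⊤, inferInstance, by rwa [Subgroup.card_top], 0, by simp⟩
  obtain ⟨P⟩ : Nonempty (Sylow p G) := inferInstance
  have hPne : (P : Subgroup G) ≠ ⊥ := P.ne_bot_of_dvd_card hpG
  have hlt : (P : Subgroup G).focalSubgroup < P :=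
    (h.focalSubgroup_le_commutator hp P).trans_lt (P.2.commutator_lt hp hPne)
  set M : Subgroup G := (P : Subgroup G).transferFocal.ker with hM
  have hMP : M ≠ ⊤ := by
    intro ht
    have := Subgroup.ker_transferFocal_inf_eq_focalSubgroup P
    rw [← hM, ht, top_inf_eq] at this
    exact hlt.ne this.symm
  have hMi : ∃ k, M.index = p ^ k := by
    obtain ⟨k, hk⟩ := ((P.2.to_quotient (P : Subgroup G).focalSubgroupOf).to_subgroup
      (P : Subgroup G).transferFocal.range).exists_card_eq
    exact ⟨k, by rw [hM, Subgroup.index_ker, hk]⟩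
  obtain ⟨k, hk⟩ := hMi
  have hMc : Nat.card M < Nat.card G :=
    lt_of_le_of_ne M.card_le_card_group fun he => hMP (Subgroup.eq_top_of_card_eq M he)
  obtain ⟨N, hN, hpN, j, hj⟩ := ih _ hMc (h.subgroup M) rfl
  -- Element orders determine `N` within `M`, so it stays normal in `G`.
  have hchar : N.Characteristic := by
    rw [Subgroup.characteristic_iff_comap_eq]
    intro f
    ext x
    rw [Subgroup.mem_comap, N.mem_iff_not_dvd_orderOf hp hpN hj,
      N.mem_iff_not_dvd_orderOf hp hpN hj]
    simp [MulEquiv.orderOf_eq]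
  refine ⟨N.map M.subtype, inferInstance, ?_, j + k, ?_⟩
  · rwa [Subgroup.card_map_of_injective M.subtype_injective]
  · rw [Subgroup.index_map_subtype, hj, hk, pow_add]

theorem mainTheorem7 {G : Type*} [Group G] [Finite G] (n p a : ℕ)
    (hn : Nat.card G = n) (hp : p.Prime)
    (hdvd : p ^ a ∣ n) (hmax : ¬ p ^ (a + 1) ∣ n)
    (hcop : Nat.gcd n (psi (p ^ a)) = 1) :
    (∀ P : Sylow p G, Nonempty (MaximalPFactorGroup p G ≃* P)) ∧
      ∃ N : Subgroup G, N.Normal ∧ ∀ P : Sylow p G, N.IsComplement' (P : Subgroup G) := by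
  have := Fact.mk hp
  subst hn
  have h : CoprimePsi p G := by
    intro q hq hqG i hi hpi hqi
    have hia : i ≤ a := by
      by_contra hlt
      exact hmax ((pow_dvd_pow p (by omega)).trans hpi)
    have hqpsi : q ∣ psi (p ^ a) := by
      rw [psi_prime_pow hp]
      exact hqi.trans (Finset.dvd_prod_of_mem _ (Finset.mem_Icc.2 ⟨hi, hia⟩))
    exact hq.one_lt.ne' (Nat.dvd_one.1 (hcop ▸ Nat.dvd_gcd hqG hqpsi))
  obtain ⟨N, hN, hpN, k, hk⟩ := h.exists_normal_not_dvd_card hp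
  have hcompl : ∀ P : Sylow p G, N.IsComplement' (P : Subgroup G) := by
    intro P
    obtain ⟨j, hj⟩ := P.2.exists_card_eq
    refine Subgroup.isComplement'_of_coprime ?_ ?_
    · have hPi : Nat.card P = N.index := by
        refine Nat.dvd_antisymm ?_ ?_
        · refine Nat.Coprime.dvd_of_dvd_mul_left (k := Nat.card P) (n := N.index)
            (m := Nat.card N) ?_ ?_
          · rw [hj]
            exact ((Nat.Prime.coprime_iff_not_dvd hp).2 hpN).pow_left j
          · rw [N.card_mul_index]
            exact (P : Subgroup G).card_subgroup_dvd_card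
        · rw [hk]
          refine Nat.Coprime.dvd_of_dvd_mul_right (n := (P : Subgroup G).index)
            (((Nat.Prime.coprime_iff_not_dvd hp).2 P.not_dvd_index).pow_left k) ?_
          rw [(P : Subgroup G).card_mul_index, ← hk]
          exact N.index_dvd_card
      rw [hPi, N.card_mul_index]
    · rw [hj]
      exact (((Nat.Prime.coprime_iff_not_dvd hp).2 hpN).pow_left j).symm
  have hres : pResidual p G = N := by
    refine le_antisymm (sInf_le ⟨hN, k, hk⟩) (le_sInf ?_)
    rintro M ⟨hM, m, hm⟩ x hx
    -- An element of order prime to `p` dies in the `p`-group `G ⧸ M`.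
    rw [N.mem_iff_not_dvd_orderOf hp hpN hk] at hx
    rw [← QuotientGroup.eq_one_iff, ← orderOf_eq_one_iff]
    refine Nat.eq_one_of_dvd_coprimes (((Nat.Prime.coprime_iff_not_dvd hp).2 hx).pow_left m) ?_
      (orderOf_map_dvd (QuotientGroup.mk' M) x)
    rw [← hm]
    exact orderOf_dvd_natCard (x : G ⧸ M)
  refine ⟨fun P => ?_, N, hN, hcompl⟩
  exact ⟨(QuotientGroup.quotientMulEquivOfEq hres).trans (hcompl P).symm.QuotientMulEquiv⟩
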